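/- Let $n\ge 2$, let $u\in\mathbb{R}^n$ be a unit vector, and let $H=u^{\perp}$. Let $\mathcal{K}^n_n$ be the class of convex bodies (compact convex sets with nonempty interior) in $\mathbb{R}^n$, and let $\mathcal{L}^n$ be the class of $\mathcal{H}^n$-measurable subsets of $\mathbb{R}^n$ of finite $\mathcal{H}^n$-measure, where $\mathcal{H}^k$ is $k$-dimensional Hausdorff measure. Write $B(x,r)$ for the closed ball with center $x$ and radius $r>0$, and $K^{\dagger}$ for the reflection of $K$ in $H$. "Essentially" means up to a set of $\mathcal{H}^n$-measure zero. For $K\in\mathcal{K}^n_n$ and $t\in\mathbb{R}$ let $$K_t=(K-tu)\cap(K^{\dagger}+tu).$$ A map $\Diamond:\mathcal{K}^n_n\to\mathcal{L}^n$ is called - *monotonic* if, for $K,L\in\mathcal{K}^n_n$, $K\subset L$ essentially implies $\Diamond K\subset\Diamond L$ essentially; - *measure preserving* if $\mathcal{H}^n(\Diamond K)=\mathcal{H}^n(K)$ for all $K\in\mathcal{K}^n_n$; - *respecting $H$-cylinders* if, for all $K\in\mathcal{K}^n_n$, $x\in\mathbb{R}^n$ and $r>0$, $K\subset (B(x,r)\cap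 H)+H^{\perp}$ essentially implies $\Diamond K\subset (B(x,r)\cap H)+H^{\perp}$ essentially; - *mapping balls to balls* if for every $x\in\mathbb{R}^n$ and $r>0$ there are $x'\in\mathbb{R}^n$ and $r'>0$ with $\Diamond B(x,r)=B(x',r')$, essentially. A *contraction* is a function $\mathbb{R}\to\mathbb{R}$ that is Lipschitz with constant $1$. If $\Diamond$ has these four properties, then there is exactly one contraction $\varphi_{\Diamond}:\mathbb{R}\to\mathbb{R}$ such that, for all $x\in H$, $t\in\mathbb{R}$ and $r>0$, $\Diamond B(x+tu,r)=B(x+\varphi_{\Diamond}(t)u,r)$, essentially. Let $\Diamond:\mathcal{K}^n_n\to\mathcal{L}^n$ be any map and let $\varphi:\mathbb{R}\to\mathbb{R}$ be a contraction. The following are equivalent. (i) $\Diamond$ is monotonic, measure preserving, respects $H$-cylinders, and maps balls to balls, and $\varphi=\varphi_{\Diamond}$. (ii) For each $K\in\mathcal{K}^n_n$, $$\Diamond K=\bigcup_{t\in\mathbb{R}}\operatorname{int}\bigl(K_t+\varphi(t)u\bigr),\quad\text{essentially.}$$ (iii) For each $K\in\mathcal{K}^n_n$ and $\mathcal{H}^{n-1}$-almost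 all $x\in H$, $$(\Diamond K)\cap(H^{\perp}+x)=\bigl(K\cap(H^{\perp}+x)\bigr)+(\varphi(t_x)-t_x)u$$ up to a set of $\mathcal{H}^1$-measure zero, where $x+t_xu$ is the midpoint of $K\cap(H^{\perp}+x)$ (if $K\cap(H^{\perp}+x)=\emptyset$, the right-hand side is empty). -/

import Mathlib

open MeasureTheory Set
open scoped Pointwise

noncomputable section

namespace ChordMovement

/-- Euclidean `n`-space. -/
abbrev E (n : ℕ) : Type := EuclideanSpace ℝ (Fin n)

/-- `k`-dimensional Hausdorff measure, normalized to agree with Lebesgue measure on `ℝ^k`. -/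
abbrev haus {X : Type} [EMetricSpace X] [MeasurableSpace X] [BorelSpace X] (k : ℕ) : Measure X :=
  Measure.euclideanHausdorffMeasure k

/-- Convex bodies: nonempty compact convex sets with interior points. -/
abbrev Body (n : ℕ) : Type := {K : ConvexBody (E n) // (interior (K : Set (E n))).Nonempty}

/-- The underlying set of a convex body. -/
def Body.set {n : ℕ} (K : Body n) : Set (E n) := (K.1 : Set (E n))

/-- Measurable (with respect to the completed measure) sets of finite `n`-dimensional measure. -/
abbrev FinMeas (n : ℕ) : Type :=
  {A : Set (E n) // NullMeasurableSet A (haus n) ∧ haus n A < ⊤}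

/-- `A ⊆ B` up to a set of `n`-dimensional measure zero. -/
def EssSubset {n : ℕ} (A B : Set (E n)) : Prop := A ≤ᵐ[haus n] B

/-- `A = B` up to a set of `n`-dimensional measure zero. -/
def EssEq {n : ℕ} (A B : Set (E n)) : Prop := A =ᵐ[haus n] B

/-- The closed ball with center `x` and radius `r > 0`, as a convex body. -/
def ball {n : ℕ} (x : E n) (r : ℝ) (hr : 0 < r) : Body n :=
  ⟨{ carrier := Metric.closedBall x r
     convex' := convex_closedBall x r
     isCompact' := isCompact_closedBall x r
     nonempty' := ⟨x, Metric.mem_closedBall_self hr.le⟩ },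
   ⟨x, Metric.ball_subset_interior_closedBall (Metric.mem_ball_self hr)⟩⟩

/-- The subspace `H = u^⊥`. -/
abbrev hyp {n : ℕ} (u : E n) : Submodule ℝ (E n) := (Submodule.span ℝ {u})ᗮ

/-- The translate `A + v`. -/
def translate {n : ℕ} (A : Set (E n)) (v : E n) : Set (E n) := (fun y => y + v) '' A

def Monotonic {n : ℕ} (D : Body n → FinMeas n) : Prop :=
  ∀ K L : Body n, EssSubset K.set L.set → EssSubset (D K).1 (D L).1

def MeasPreserving {n : ℕ} (D : Body n → FinMeas n) : Prop :=
  ∀ K : Body n, haus n (D K).1 = haus n K.set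

/-- The cylinder `(B(x,r) ∩ H) + H^⊥`. -/
def cylinder {n : ℕ} (H : Submodule ℝ (E n)) (x : E n) (r : ℝ) : Set (E n) :=
  (Metric.closedBall x r ∩ (H : Set (E n))) + (Hᗮ : Set (E n))

def RespectsCylinders {n : ℕ} (H : Submodule ℝ (E n)) (D : Body n → FinMeas n) : Prop :=
  ∀ (K : Body n) (x : E n) (r : ℝ), 0 < r →
    EssSubset K.set (cylinder H x r) → EssSubset (D K).1 (cylinder H x r)

def MapsBallsToBalls {n : ℕ} (D : Body n → FinMeas n) : Prop :=
  ∀ (x : E n) (r : ℝ) (hr : 0 < r), ∃ (x' : E n) (r' : ℝ) (hr' : 0 < r'),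
    EssEq (D (ball x r hr)).1 (ball x' r' hr').set

/-- `ψ` is a contraction with `D B(x + tu, r) = B(x + ψ(t)u, r)`, essentially, for all
`x ∈ u^⊥`, `t ∈ ℝ` and `r > 0`. -/
def IsBallShift {n : ℕ} (u : E n) (D : Body n → FinMeas n) (ψ : ℝ → ℝ) : Prop :=
  LipschitzWith 1 ψ ∧ ∀ x ∈ hyp u, ∀ (t r : ℝ) (hr : 0 < r),
    EssEq (D (ball (x + t • u) r hr)).1 (ball (x + ψ t • u) r hr).set

open Classical in
/-- The contraction `φ_D` associated with `D`: the function `ψ` with `IsBallShift u D ψ`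
(at most one exists when `u ≠ 0`; the value `0` is used if there is none). -/
def ballShift {n : ℕ} (u : E n) (D : Body n → FinMeas n) : ℝ → ℝ :=
  if h : ∃ ψ : ℝ → ℝ, IsBallShift u D ψ then h.choose else 0

/-- `K_t = (K - tu) ∩ (K† + tu)`, where `K†` is the reflection of `K` in `u^⊥`. -/
def symPart {n : ℕ} (u : E n) (K : Set (E n)) (t : ℝ) : Set (E n) :=
  translate K (-(t • u)) ∩ translate ((hyp u).reflection '' K) (t • u)

/-- The line `H^⊥ + x`. -/
def perpLine {n : ℕ} (H : Submodule ℝ (E n)) (x : E n) : Set (E n) :=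
  translate (Hᗮ : Set (E n)) x

/-- The height `t_x` for which `x + t_x u` is the midpoint of the chord of `K` on the line
through `x` in direction `u` (the value is irrelevant where the chord is empty). -/
def midHeight {n : ℕ} (u : E n) (K : Set (E n)) (x : E n) : ℝ :=
  (sInf {s : ℝ | x + s • u ∈ K} + sSup {s : ℝ | x + s • u ∈ K}) / 2

end ChordMovement

end

/-!
Write points as `x + s u` with `x ∈ u^⊥`. The slice `int (K_t + φ(t) u)` consists of the `x + s u`
for which both `t ± (s - φ(t))` lie in the chord of `int K` over `x`. As `φ` is a contraction, these
slices together fill exactly the open chord of `K` over `x` moved by `φ(t_x) - t_x`, so Fubini gives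
the equivalence of (ii) and (iii) and shows that the set in (ii) has the volume of `K`.

For (i) ⇒ (ii), the image of a ball is a ball of the same radius (volume) over the same point of
`u^⊥` (cylinders). The heights agree for internally tangent balls centered at equal heights, hence
depend only on the height of the center; nested balls over one point show that the dependence `φ` is
a contraction. A drum of radius `ρ` and half-height `a` around height `t` lies in a cylinder of
radius `ρ` and a ball of radius `a + ρ² / (2a)`, so by volume its image fills the drum moved to
height `φ(t)` up to an error that is negligible against a ball of radius `ρ`. Such drums inside `K`
make every point of the set in (ii) a Lebesgue density point of `◇K`, which by equality of volumes
is then essentially that set.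
-/

namespace ChordMovement

open Filter Topology
open Metric (closedBall)

section Metric

lemma closedBall_subset_closedBall_iff {V : Type*} [NormedAddCommGroup V] [NormedSpace ℝ V]
    [Nontrivial V] {p q : V} {r s : ℝ} (hr : 0 ≤ r) :
    closedBall p r ⊆ closedBall q s ↔ r + dist p q ≤ s := by
  refine ⟨fun h => ?_, Metric.closedBall_subset_closedBall'⟩
  obtain ⟨e, he, hpq⟩ : ∃ e : V, ‖e‖ = 1 ∧ p - q = ‖p - q‖ • e := by
    rcases eq_or_ne (p - q) 0 with h0 | h0
    · obtain ⟨e, he⟩ := exists_norm_eq V zero_le_one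
      exact ⟨e, he, by simp [h0]⟩
    · exact ⟨‖p - q‖⁻¹ • (p - q), norm_smul_inv_norm h0,
        (smul_inv_smul₀ (norm_ne_zero_iff.2 h0) _).symm⟩
  have hfar : p + r • e ∈ closedBall q s :=
    h (by simp [norm_smul, he, abs_of_nonneg hr])
  have hsplit : p + r • e - q = (r + ‖p - q‖) • e := by
    rw [add_smul, ← hpq]; abel
  rwa [Metric.mem_closedBall, dist_eq_norm, hsplit, norm_smul, he, mul_one,
    Real.norm_of_nonneg (by positivity), ← dist_eq_norm] at hfar

lemma eq_of_closedBall_subset_closedBall {V : Type*} [NormedAddCommGroup V] [NormedSpace ℝ V]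
    {p q : V} {r : ℝ} (hr : 0 ≤ r) (h : closedBall p r ⊆ closedBall q r) : p = q := by
  rcases subsingleton_or_nontrivial V with _ | _
  · exact Subsingleton.elim p q
  · exact dist_le_zero.1 (by linarith [(closedBall_subset_closedBall_iff hr).1 h])

/-- Two balls are compared through balls that contain both of them tangentially; balls with the
same center are first compared through a ball with a different center. -/
lemma eq_of_forall_internally_tangent {V α : Type*} [NormedAddCommGroup V] [NormedSpace ℝ V]
    [Nontrivial V] {g : V → ℝ → α}
    (hg : ∀ x y r s, 0 < s → s + dist y x = r → g y s = g x r)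
    (x y : V) {r s : ℝ} (hr : 0 < r) (hs : 0 < s) : g x r = g y s := by
  have concentric : ∀ x r s, 0 < s → s ≤ r → g x s = g x r := by
    intro x r s hs hsr
    obtain ⟨v, hv⟩ := exists_norm_eq V (show 0 ≤ (r - s) / 2 by linarith)
    calc g x s = g (x + v) ((r + s) / 2) :=
          hg _ _ _ _ hs (by rw [dist_self_add_right, hv]; ring)
      _ = g x r := hg _ _ _ _ (by linarith) (by rw [dist_self_add_left, hv]; ring)
  calc g x r = g y (r + dist x y) := hg _ _ _ _ hr rfl
    _ = g y s := by
      rcases le_total s (r + dist x y) with h | h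
      · exact (concentric y _ _ hs h).symm
      · exact concentric y _ _ (by positivity) h

end Metric

section Convexity

lemma preimage_interior_eq_interior_preimage {V W : Type*}
    [AddCommGroup V] [Module ℝ V] [TopologicalSpace V] [IsTopologicalAddGroup V]
    [ContinuousSMul ℝ V] [AddCommGroup W] [Module ℝ W] [TopologicalSpace W]
    [IsTopologicalAddGroup W] [ContinuousSMul ℝ W] (f : V →ᴬ[ℝ] W) {K : Set W}
    (hK : Convex ℝ K) (hne : (f ⁻¹' interior K).Nonempty) :
    f ⁻¹' interior K = interior (f ⁻¹' K) := by
  have hopen : IsOpen (f ⁻¹' interior K) := isOpen_interior.preimage f.continuous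
  refine subset_antisymm (hopen.subset_interior_iff.2 (preimage_mono interior_subset)) ?_
  obtain ⟨p, hp⟩ := hne
  have hdense : f ⁻¹' K ⊆ closure (f ⁻¹' interior K) := fun c hc => by
    have hseg : openSegment ℝ p c ⊆ f ⁻¹' interior K := by
      rw [← image_subset_iff, ← f.coe_toAffineMap, image_openSegment]
      exact hK.openSegment_interior_self_subset_interior hp hc
    exact closure_mono hseg (segment_subset_closure_openSegment (right_mem_segment ℝ p c))
  calc interior (f ⁻¹' K) ⊆ interior (closure (f ⁻¹' interior K)) := interior_mono hdense
    _ = f ⁻¹' interior K := by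
      have hconv : Convex ℝ (f ⁻¹' interior K) := hK.interior.affine_preimage f.toAffineMap
      rw [hconv.interior_closure_eq_interior_of_nonempty_interior
        (by rw [hopen.interior_eq]; exact ⟨p, hp⟩), hopen.interior_eq]

end Convexity

section Measure

lemma subset_of_ae_le_of_subset_closure_interior {X : Type*} [TopologicalSpace X]
    [MeasurableSpace X] {μ : Measure X} [μ.IsOpenPosMeasure] {K F : Set X}
    (hK : K ⊆ closure (interior K)) (hF : IsClosed F) (h : K ≤ᵐ[μ] F) : K ⊆ F := by
  have hnull : μ (interior K \ F) = 0 :=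
    measure_mono_null (sdiff_subset_sdiff_left interior_subset) (ae_le_set.1 h)
  have hempty : interior K \ F = ∅ := ((isOpen_interior.sdiff hF).measure_eq_zero_iff μ).1 hnull
  exact hK.trans (closure_minimal (sdiff_eq_empty.1 hempty) hF)

lemma radius_eq_of_addHaar_closedBall_eq {V : Type*} [NormedAddCommGroup V] [NormedSpace ℝ V]
    [FiniteDimensional ℝ V] [Nontrivial V] [MeasurableSpace V] [BorelSpace V] {μ : Measure V}
    [μ.IsAddHaarMeasure] {p q : V} {r s : ℝ} (hr : 0 ≤ r) (hs : 0 ≤ s)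
    (h : μ (closedBall p r) = μ (closedBall q s)) : r = s := by
  rw [Measure.addHaar_closedBall _ _ hr, Measure.addHaar_closedBall _ _ hs,
    ENNReal.mul_left_inj (Metric.measure_ball_pos _ _ one_pos).ne' measure_ball_lt_top.ne,
    ENNReal.ofReal_eq_ofReal_iff (by positivity) (by positivity)] at h
  exact (pow_left_inj₀ hr hs Module.finrank_pos.ne').1 h

lemma ball_ae_eq_closedBall {V : Type*} [NormedAddCommGroup V] [NormedSpace ℝ V]
    [FiniteDimensional ℝ V] [Nontrivial V] [MeasurableSpace V] [BorelSpace V] {μ : Measure V}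
    [μ.IsAddHaarMeasure] (p : V) (r : ℝ) : Metric.ball p r =ᵐ[μ] closedBall p r :=
  ae_eq_of_subset_of_measure_ge Metric.ball_subset_closedBall
    (Measure.addHaar_closedBall_eq_addHaar_ball _ _ _).le
    measurableSet_ball.nullMeasurableSet measure_closedBall_lt_top.ne

lemma ae_le_of_tendsto_measure_closedBall_sdiff {X : Type*} [MetricSpace X] [MeasurableSpace X]
    [BorelSpace X] [SecondCountableTopology X] [HasBesicovitchCovering X] {μ : Measure X}
    [IsLocallyFiniteMeasure μ] {S A : Set X} (hA : NullMeasurableSet A μ)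
    (h : ∀ z ∈ S, Tendsto (fun ρ => μ (closedBall z ρ \ A) / μ (closedBall z ρ))
      (𝓝[>] 0) (𝓝 0)) :
    S ≤ᵐ[μ] A := by
  filter_upwards [(ae_restrict_iff'₀ hA.compl).1 (Besicovitch.ae_tendsto_measure_inter_div μ Aᶜ)]
    with z hdensity hzS
  by_contra hzA
  have hone := hdensity hzA
  simp only [inter_comm Aᶜ, ← sdiff_eq] at hone
  exact one_ne_zero (tendsto_nhds_unique hone (h z hzS))

end Measure

section AxisCoordinates

variable {V : Type*} [NormedAddCommGroup V] [InnerProductSpace ℝ V] {u : V}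

lemma exists_eq_add_smul (u y : V) : ∃ (x : (ℝ ∙ u)ᗮ) (s : ℝ), y = x + s • u := by
  obtain ⟨v, hv, x, hx, rfl⟩ := (ℝ ∙ u).exists_add_mem_mem_orthogonal y
  obtain ⟨s, rfl⟩ := Submodule.mem_span_singleton.1 hv
  exact ⟨⟨x, hx⟩, s, add_comm _ _⟩

lemma dist_sq_add_smul (hu : ‖u‖ = 1) (x y : (ℝ ∙ u)ᗮ) (s t : ℝ) :
    dist ((x : V) + s • u) (y + t • u) ^ 2 = dist x y ^ 2 + (s - t) ^ 2 := by
  have hsplit : (x : V) + s • u - (y + t • u) = ((x - y : (ℝ ∙ u)ᗮ) : V) + (s - t) • u := by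
    push_cast; module
  have horth : inner ℝ ((x - y : (ℝ ∙ u)ᗮ) : V) ((s - t) • u) = 0 := by
    rw [inner_smul_right, Submodule.mem_orthogonal_singleton_iff_inner_left.1 (x - y).2, mul_zero]
  rw [dist_eq_norm, hsplit, norm_add_sq_real, horth, norm_smul, hu, dist_eq_norm]
  simp

lemma dist_le_dist_add_smul (hu : ‖u‖ = 1) (x y : (ℝ ∙ u)ᗮ) (s t : ℝ) :
    dist x y ≤ dist ((x : V) + s • u) (y + t • u) :=
  (sq_le_sq₀ dist_nonneg dist_nonneg).1 (by nlinarith [dist_sq_add_smul hu x y s t])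

lemma abs_sub_le_dist_add_smul (hu : ‖u‖ = 1) (x y : (ℝ ∙ u)ᗮ) (s t : ℝ) :
    |s - t| ≤ dist ((x : V) + s • u) (y + t • u) :=
  abs_le_of_sq_le_sq (by nlinarith [dist_sq_add_smul hu x y s t]) dist_nonneg

lemma eq_of_dist_add_smul_le (hu : ‖u‖ = 1) {x y : (ℝ ∙ u)ᗮ} {s t : ℝ}
    (h : dist ((x : V) + s • u) (y + t • u) ≤ dist x y) : s = t := by
  have hsq : (s - t) ^ 2 ≤ 0 := by
    linarith [dist_sq_add_smul hu x y s t, pow_le_pow_left₀ dist_nonneg h 2]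
  exact sub_eq_zero.1 (pow_eq_zero_iff two_ne_zero |>.1 (hsq.antisymm (sq_nonneg _)))

lemma add_smul_mem_closedBall_iff (hu : ‖u‖ = 1) {x y : (ℝ ∙ u)ᗮ} {s t r : ℝ} (hr : 0 ≤ r) :
    (x : V) + s • u ∈ closedBall (y + t • u : V) r ↔ dist x y ^ 2 + (s - t) ^ 2 ≤ r ^ 2 := by
  rw [Metric.mem_closedBall, ← dist_sq_add_smul hu, sq_le_sq₀ dist_nonneg hr]

lemma add_smul_mem_ball_iff (hu : ‖u‖ = 1) {x y : (ℝ ∙ u)ᗮ} {s t r : ℝ} (hr : 0 ≤ r) :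
    (x : V) + s • u ∈ Metric.ball (y + t • u : V) r ↔ dist x y ^ 2 + (s - t) ^ 2 < r ^ 2 := by
  rw [Metric.mem_ball, ← dist_sq_add_smul hu, sq_lt_sq₀ dist_nonneg hr]

lemma isometry_add_smul (hu : ‖u‖ = 1) (x : V) : Isometry fun s : ℝ => x + s • u :=
  (IsometryEquiv.addLeft x).isometry.comp (LinearIsometry.toSpanSingleton ℝ V hu).isometry

lemma starProjection_orthogonal_span_add_smul (x : (ℝ ∙ u)ᗮ) (s : ℝ) :
    (ℝ ∙ u)ᗮ.starProjection ((x : V) + s • u) = x :=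
  Submodule.eq_starProjection_of_mem_orthogonal' x.2
    (Submodule.le_orthogonal_orthogonal _
      (Submodule.smul_mem _ s (Submodule.mem_span_singleton_self u))) rfl

lemma reflection_orthogonal_span_add_smul (x : (ℝ ∙ u)ᗮ) (s : ℝ) :
    (ℝ ∙ u)ᗮ.reflection ((x : V) + s • u) = x + (-s) • u := by
  rw [Submodule.reflection_apply, starProjection_orthogonal_span_add_smul]
  module

/-- Orthogonal coordinates: the pair `(x, s)` stands for the point `x + s u`. -/
noncomputable def axisIsometryEquiv (hu : ‖u‖ = 1) : WithLp 2 ((ℝ ∙ u)ᗮ × ℝ) ≃ₗᵢ[ℝ] V :=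
  (LinearIsometryEquiv.withLpProdComm 2 ℝ (ℝ ∙ u)ᗮ ℝ).trans <|
    (LinearIsometryEquiv.withLpProdCongr 2 (LinearIsometryEquiv.toSpanUnitSingleton u hu)
      (LinearIsometryEquiv.refl ℝ (ℝ ∙ u)ᗮ)).trans (ℝ ∙ u).orthogonalDecomposition.symm

/-- The coordinates `axisIsometryEquiv` read on the plain product `u^⊥ × ℝ`, whose sup norm makes
them a linear homeomorphism only. -/
noncomputable def axisEquiv (hu : ‖u‖ = 1) : ((ℝ ∙ u)ᗮ × ℝ) ≃L[ℝ] V :=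
  (WithLp.prodContinuousLinearEquiv 2 ℝ (ℝ ∙ u)ᗮ ℝ).symm.trans
    (axisIsometryEquiv hu).toContinuousLinearEquiv

@[simp]
lemma axisEquiv_apply (hu : ‖u‖ = 1) (p : (ℝ ∙ u)ᗮ × ℝ) : axisEquiv hu p = p.1 + p.2 • u :=
  ((ℝ ∙ u).orthogonalDecomposition_symm_apply _).trans (add_comm _ _)

lemma measurePreserving_axisEquiv [FiniteDimensional ℝ V] [MeasurableSpace V] [BorelSpace V]
    (hu : ‖u‖ = 1) : MeasurePreserving (axisEquiv hu) (volume.prod volume) volume :=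
  (axisIsometryEquiv hu).measurePreserving.comp (WithLp.volume_preserving_toLp (ℝ ∙ u)ᗮ ℝ)

end AxisCoordinates

section Chord

variable {V : Type*} [NormedAddCommGroup V] [InnerProductSpace ℝ V] {u : V}

/-- The chord of `A` on the line through `x` in direction `u`, recorded as the set of heights `s`
with `x + s u ∈ A`. -/
def chord (u : V) (A : Set V) (x : V) : Set ℝ := {s | x + s • u ∈ A}

@[simp]
lemma mem_chord {A : Set V} {x : V} {s : ℝ} : s ∈ chord u A x ↔ x + s • u ∈ A := Iff.rfl

lemma convex_chord {K : Set V} (hK : Convex ℝ K) (x : V) : Convex ℝ (chord u K x) :=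
  (hK.translate_preimage_right x).linear_preimage (LinearMap.toSpanSingleton ℝ V u)

lemma isCompact_chord (hu : ‖u‖ = 1) {K : Set V} (hK : IsCompact K) (x : V) :
    IsCompact (chord u K x) :=
  (isometry_add_smul hu x).isClosedEmbedding.isCompact_preimage hK

lemma chord_interior {K : Set V} (hK : Convex ℝ K) {x : V}
    (hne : (chord u (interior K) x).Nonempty) : chord u (interior K) x = interior (chord u K x) :=
  preimage_interior_eq_interior_preimage
    (ContinuousAffineMap.const ℝ ℝ x +
      (ContinuousLinearMap.toSpanSingleton ℝ u).toContinuousAffineMap) hK hne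

lemma exists_chord_eq_Icc (hu : ‖u‖ = 1) {K : Set V} (hK : Convex ℝ K) (hKc : IsCompact K) {x : V}
    (hne : (chord u (interior K) x).Nonempty) :
    ∃ a b, a < b ∧ chord u K x = Icc a b ∧ chord u (interior K) x = Ioo a b := by
  have hchord_ne : (chord u K x).Nonempty := hne.mono fun s hs => interior_subset (s := K) hs
  obtain ⟨a, b, hIcc⟩ : ∃ a b, chord u K x = Icc a b :=
    ⟨_, _, eq_Icc_of_connected_compact ⟨hchord_ne, (convex_chord hK x).isPreconnected⟩
      (isCompact_chord hu hKc x)⟩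
  have hIoo : chord u (interior K) x = Ioo a b := by
    rw [chord_interior hK hne, hIcc, interior_Icc]
  exact ⟨a, b, nonempty_Ioo.1 (hIoo ▸ hne), hIcc, hIoo⟩

variable [FiniteDimensional ℝ V] [MeasurableSpace V] [BorelSpace V]

lemma ae_chord_ae_eq_of_ae_eq (hu : ‖u‖ = 1) {A B : Set V} (h : A =ᵐ[volume] B) :
    ∀ᵐ x : (ℝ ∙ u)ᗮ, chord u A x =ᵐ[volume] chord u B x := by
  have hcoord := (measurePreserving_axisEquiv hu).quasiMeasurePreserving
  filter_upwards [Measure.ae_ae_of_ae_prod (hcoord.ae h.mem_iff)] with x hx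
  simpa only [eventuallyEq_set, mem_chord, axisEquiv_apply] using hx

lemma volume_eq_lintegral_chord (hu : ‖u‖ = 1) {A : Set V} (hA : NullMeasurableSet A volume) :
    volume A = ∫⁻ x : (ℝ ∙ u)ᗮ, volume (chord u A x) := by
  obtain ⟨B, hB, hAB⟩ := hA
  calc volume A = volume (axisEquiv hu ⁻¹' B) := by
        rw [measure_congr hAB, Measure.volume_eq_prod,
          (measurePreserving_axisEquiv hu).measure_preimage hB.nullMeasurableSet]
    _ = ∫⁻ x : (ℝ ∙ u)ᗮ, volume (chord u B x) := by
        rw [Measure.volume_eq_prod, Measure.prod_apply ((axisEquiv hu).continuous.measurable hB)]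
        simp only [chord, preimage, axisEquiv_apply, mem_ofPred_eq]
    _ = ∫⁻ x : (ℝ ∙ u)ᗮ, volume (chord u A x) :=
        lintegral_congr_ae ((ae_chord_ae_eq_of_ae_eq hu hAB.symm).mono fun x hx => measure_congr hx)

lemma ae_eq_iff_chord (hu : ‖u‖ = 1) {A B : Set V} (hA : NullMeasurableSet A volume)
    (hB : NullMeasurableSet B volume) :
    A =ᵐ[volume] B ↔ ∀ᵐ x : (ℝ ∙ u)ᗮ, chord u A x =ᵐ[volume] chord u B x := by
  refine ⟨ae_chord_ae_eq_of_ae_eq hu, fun h => measure_symmDiff_eq_zero_iff.1 ?_⟩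
  rw [volume_eq_lintegral_chord hu (hA.symmDiff hB)]
  exact lintegral_eq_zero_of_ae_eq_zero (h.mono fun x hx => measure_symmDiff_eq_zero_iff.2 hx)

end Chord

section EuclideanSpace

variable {n : ℕ} {u : E n}

lemma haus_eq_volume (n : ℕ) : (haus n : Measure (E n)) = volume :=
  EuclideanSpace.euclideanHausdorffMeasure_eq_volume n

lemma essSubset_iff {A B : Set (E n)} : EssSubset A B ↔ A ≤ᵐ[volume] B := by
  rw [EssSubset, haus_eq_volume]

lemma essEq_iff {A B : Set (E n)} : EssEq A B ↔ A =ᵐ[volume] B := by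
  rw [EssEq, haus_eq_volume]

lemma FinMeas.nullMeasurableSet (A : FinMeas n) : NullMeasurableSet A.1 volume :=
  haus_eq_volume n ▸ A.2.1

lemma MeasPreserving.volume_eq {D : Body n → FinMeas n} (hD : MeasPreserving D) (K : Body n) :
    volume (D K).1 = volume K.set :=
  haus_eq_volume n ▸ hD K

lemma finrank_hyp (hu : ‖u‖ = 1) : Module.finrank ℝ (hyp u) + 1 = n := by
  have hsum := Submodule.finrank_add_finrank_orthogonal (ℝ ∙ u)
  rwa [finrank_span_singleton (ne_zero_of_norm_ne_zero (hu ▸ one_ne_zero)),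
    finrank_euclideanSpace_fin, add_comm] at hsum

lemma haus_hyp_eq_volume (hu : ‖u‖ = 1) : (haus (n - 1) : Measure (hyp u)) = volume := by
  rw [← Nat.eq_sub_of_add_eq (finrank_hyp hu)]
  exact InnerProductSpace.euclideanHausdorffMeasure_eq_volume

lemma mem_translate {A : Set (E n)} {v y : E n} : y ∈ translate A v ↔ y - v ∈ A := by
  simp [translate, sub_eq_add_neg]

lemma interior_translate (A : Set (E n)) (v : E n) :
    interior (translate A v) = translate (interior A) v :=
  ((Homeomorph.addRight v).image_interior A).symm

lemma inter_perpLine (A : Set (E n)) (x : E n) :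
    A ∩ perpLine (hyp u) x = (fun s : ℝ => x + s • u) '' chord u A x := by
  ext y
  simp only [perpLine, mem_inter_iff, mem_translate, Submodule.orthogonal_orthogonal,
    SetLike.mem_coe, Submodule.mem_span_singleton, mem_image, mem_chord, eq_sub_iff_add_eq']
  constructor
  · rintro ⟨hy, s, rfl⟩
    exact ⟨s, hy, rfl⟩
  · rintro ⟨s, hs, rfl⟩
    exact ⟨hs, s, rfl⟩

lemma translate_image_add_smul (S : Set ℝ) (x : E n) (c : ℝ) :
    translate ((fun s : ℝ => x + s • u) '' S) (c • u) =
      (fun s : ℝ => x + s • u) '' ((· + c) '' S) := by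
  simp only [translate, image_image, add_smul, add_assoc]

lemma haus_one_image_add_smul_ae_eq_iff (hu : ‖u‖ = 1) (x : E n) {S T : Set ℝ} :
    (fun s : ℝ => x + s • u) '' S =ᵐ[haus 1] (fun s : ℝ => x + s • u) '' T ↔
      S =ᵐ[volume] T := by
  have hline := isometry_add_smul hu x
  have hvolume : (Measure.euclideanHausdorffMeasure 1 : Measure ℝ) = volume := by
    rw [← InnerProductSpace.euclideanHausdorffMeasure_eq_volume (V := ℝ), Module.finrank_self]
  rw [← measure_symmDiff_eq_zero_iff, ← measure_symmDiff_eq_zero_iff,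
    ← image_symmDiff hline.injective, hline.euclideanHausdorffMeasure_image, hvolume]

lemma Body.convex (K : Body n) : Convex ℝ K.set := K.1.convex

lemma Body.isCompact (K : Body n) : IsCompact K.set := K.1.isCompact

lemma Body.closure_interior (K : Body n) : closure (interior K.set) = K.set := by
  rw [K.convex.closure_interior_eq_closure_of_nonempty_interior K.2,
    K.isCompact.isClosed.closure_eq]

lemma Body.interior_ae_eq (K : Body n) : interior K.set =ᵐ[volume] K.set :=
  interior_ae_eq_of_null_frontier (K.convex.addHaar_frontier volume)

lemma Body.subset_of_essSubset {K : Body n} {F : Set (E n)} (hF : IsClosed F)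
    (h : EssSubset K.set F) : K.set ⊆ F :=
  subset_of_ae_le_of_subset_closure_interior K.closure_interior.ge hF (essSubset_iff.1 h)

lemma ball_set (x : E n) (r : ℝ) (hr : 0 < r) : (ball x r hr).set = closedBall x r := rfl

end EuclideanSpace

section MovedSet

variable {n : ℕ} {u : E n} {φ : ℝ → ℝ}

/-- The right-hand side `⋃ int (K_t + φ(t) u)` of (ii). -/
def movedSet (u : E n) (φ : ℝ → ℝ) (K : Set (E n)) : Set (E n) :=
  ⋃ t : ℝ, interior (translate (symPart u K t) (φ t • u))

lemma isOpen_movedSet (u : E n) (φ : ℝ → ℝ) (K : Set (E n)) : IsOpen (movedSet u φ K) :=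
  isOpen_iUnion fun _ => isOpen_interior

lemma movedSet_mono {K L : Set (E n)} (h : K ⊆ L) : movedSet u φ K ⊆ movedSet u φ L :=
  iUnion_mono fun _ => interior_mono <| image_mono <|
    inter_subset_inter (image_mono h) (image_mono (image_mono h))

lemma mem_chord_movedSet {K : Set (E n)} {x : hyp u} {s : ℝ} :
    s ∈ chord u (movedSet u φ K) x ↔
      ∃ t, t + (s - φ t) ∈ chord u (interior K) x ∧ t - (s - φ t) ∈ chord u (interior K) x := by
  have hrefl : interior ((hyp u).reflection '' K) = (hyp u).reflection '' interior K :=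
    ((hyp u).reflection.toHomeomorph.image_interior K).symm
  simp only [movedSet, mem_iUnion, interior_translate, symPart, interior_inter, mem_translate,
    mem_inter_iff, hrefl, mem_chord]
  refine exists_congr fun t => and_congr ?_ ?_
  · rw [show (x : E n) + s • u - φ t • u - -(t • u) = x + (t + (s - φ t)) • u by module]
  · rw [show (x : E n) + s • u - φ t • u - t • u = x + (-(t - (s - φ t))) • u by module,
      ← reflection_orthogonal_span_add_smul, (hyp u).reflection.injective.mem_set_image]

lemma mem_Ioo_add_sub_iff {a b t v : ℝ} :
    t + v ∈ Ioo a b ∧ t - v ∈ Ioo a b ↔ |t - (a + b) / 2| + |v| < (b - a) / 2 := by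
  constructor
  · rintro ⟨⟨_, _⟩, _, _⟩
    rcases abs_cases (t - (a + b) / 2) with ⟨h, _⟩ | ⟨h, _⟩ <;>
      rcases abs_cases v with ⟨h', _⟩ | ⟨h', _⟩ <;> rw [h, h'] <;> linarith
  · intro h
    have := abs_le.1 (le_refl |t - (a + b) / 2|)
    have := abs_le.1 (le_refl |v|)
    constructor <;> constructor <;> linarith

/-- Since `φ` is a contraction, `|s - φ m| ≤ |s - φ t| + |t - m|`, so the slice at the midpoint
height `t = m` covers all the others. -/
lemma chord_movedSet_of_chord_interior_eq (hφ : LipschitzWith 1 φ) {K : Set (E n)} {x : hyp u}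
    {a b m : ℝ} (hm : m = (a + b) / 2) (hK : chord u (interior K) x = Ioo a b) :
    chord u (movedSet u φ K) x = Ioo (a + (φ m - m)) (b + (φ m - m)) := by
  subst hm
  ext s
  rw [mem_chord_movedSet, hK]
  simp only [mem_Ioo_add_sub_iff]
  set m := (a + b) / 2 with hm
  calc (∃ t, |t - m| + |s - φ t| < (b - a) / 2) ↔ |s - φ m| < (b - a) / 2 := by
        refine ⟨fun ⟨t, ht⟩ => ?_, fun h => ⟨m, by rwa [sub_self, abs_zero, zero_add]⟩⟩
        have hcontr : |φ t - φ m| ≤ |t - m| := by simpa [Real.dist_eq] using hφ.dist_le_mul t m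
        linarith [abs_sub_le s (φ t) (φ m)]
    _ ↔ s ∈ Ioo (a + (φ m - m)) (b + (φ m - m)) := by
        rw [abs_lt, mem_Ioo]
        constructor <;> rintro ⟨_, _⟩ <;> constructor <;> linarith

lemma midHeight_of_chord_eq_Icc {K : Set (E n)} {x : E n} {a b : ℝ} (hab : a ≤ b)
    (hK : chord u K x = Icc a b) : midHeight u K x = (a + b) / 2 := by
  rw [chord] at hK
  rw [midHeight, hK, csInf_Icc hab, csSup_Icc hab]

lemma ae_chord_movedSet (hu : ‖u‖ = 1) (hφ : LipschitzWith 1 φ) (K : Body n) :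
    ∀ᵐ x : hyp u, chord u (movedSet u φ K.set) x =ᵐ[volume]
      (· + (φ (midHeight u K.set x) - midHeight u K.set x)) '' chord u K.set x := by
  filter_upwards [ae_chord_ae_eq_of_ae_eq hu K.interior_ae_eq] with x hx
  rcases (chord u (interior K.set) x).eq_empty_or_nonempty with hempty | hne
  · have hmoved : chord u (movedSet u φ K.set) x = ∅ := by
      refine eq_empty_of_forall_notMem fun s hs => ?_
      obtain ⟨t, ht, -⟩ := mem_chord_movedSet.1 hs
      exact notMem_empty _ (hempty ▸ ht)
    rw [hempty] at hx
    rw [hmoved, image_add_right]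
    exact (ae_eq_empty.2 ((measure_preimage_add_right _ _ _).trans (ae_eq_empty.1 hx.symm))).symm
  · obtain ⟨a, b, hab, hIcc, hIoo⟩ := exists_chord_eq_Icc hu K.convex K.isCompact hne
    rw [chord_movedSet_of_chord_interior_eq hφ (midHeight_of_chord_eq_Icc hab.le hIcc) hIoo, hIcc,
      image_add_const_Icc]
    exact Ioo_ae_eq_Icc

lemma volume_movedSet (hu : ‖u‖ = 1) (hφ : LipschitzWith 1 φ) (K : Body n) :
    volume (movedSet u φ K.set) = volume K.set := by
  rw [volume_eq_lintegral_chord hu (isOpen_movedSet u φ K.set).nullMeasurableSet,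
    volume_eq_lintegral_chord hu K.isCompact.isClosed.nullMeasurableSet]
  refine lintegral_congr_ae ?_
  filter_upwards [ae_chord_movedSet hu hφ K] with x hx
  rw [measure_congr hx, image_add_right, measure_preimage_add_right]

lemma essEq_movedSet_iff (hu : ‖u‖ = 1) (hφ : LipschitzWith 1 φ) (K : Body n) (A : FinMeas n) :
    EssEq A.1 (movedSet u φ K.set) ↔
      ∀ᵐ x : hyp u ∂(haus (n - 1)),
        (A.1 ∩ perpLine (hyp u) (x : E n) : Set (E n)) =ᵐ[haus 1]
          (translate (K.set ∩ perpLine (hyp u) (x : E n))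
            ((φ (midHeight u K.set x) - midHeight u K.set x) • u) : Set (E n)) := by
  rw [essEq_iff, haus_hyp_eq_volume hu, ae_eq_iff_chord hu A.nullMeasurableSet
    (isOpen_movedSet u φ K.set).nullMeasurableSet]
  refine eventually_congr ?_
  filter_upwards [ae_chord_movedSet hu hφ K] with x hx
  rw [inter_perpLine, inter_perpLine, translate_image_add_smul,
    haus_one_image_add_smul_ae_eq_iff hu]
  exact ⟨fun h => h.trans hx, fun h => h.trans hx.symm⟩

end MovedSet

section Cylinder

variable {n : ℕ} {u : E n} {H : Submodule ℝ (E n)}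

lemma mem_cylinder {c y : E n} {r : ℝ} :
    y ∈ cylinder H c r ↔ H.starProjection y ∈ closedBall c r := by
  rw [cylinder, Set.mem_add]
  constructor
  · rintro ⟨p, ⟨hpc, hp⟩, q, hq, rfl⟩
    rwa [Submodule.eq_starProjection_of_mem_orthogonal' hp hq rfl]
  · exact fun h => ⟨_, ⟨h, H.starProjection_apply_mem y⟩, _,
      H.sub_starProjection_mem_orthogonal y, add_sub_cancel _ _⟩

lemma add_smul_mem_cylinder {x : hyp u} {c : E n} {s r : ℝ} :
    (x : E n) + s • u ∈ cylinder (hyp u) c r ↔ (x : E n) ∈ closedBall c r := by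
  rw [mem_cylinder, starProjection_orthogonal_span_add_smul]

lemma isClosed_cylinder (H : Submodule ℝ (E n)) (c : E n) (r : ℝ) : IsClosed (cylinder H c r) := by
  have hpreimage : cylinder H c r = H.starProjection ⁻¹' closedBall c r :=
    Set.ext fun _ => mem_cylinder
  exact hpreimage ▸ Metric.isClosed_closedBall.preimage H.starProjection.continuous

lemma closedBall_subset_cylinder (H : Submodule ℝ (E n)) (c : E n) (r : ℝ) :
    closedBall c r ⊆ cylinder H (H.starProjection c) r := fun y hy =>
  mem_cylinder.2 ((H.lipschitzWith_starProjection.dist_le_mul y c).trans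
    (by simpa using hy))

lemma starProjection_eq_of_closedBall_subset_cylinder {p c : E n} {r : ℝ} (hr : 0 ≤ r)
    (hc : c ∈ H) (h : closedBall p r ⊆ cylinder H c r) : H.starProjection p = c := by
  suffices hsub : closedBall (H.orthogonalProjectionOnto p) r ⊆ closedBall (⟨c, hc⟩ : H) r from
    congrArg Subtype.val (eq_of_closedBall_subset_closedBall hr hsub)
  intro z hz
  have hlift : (z : E n) + (p - H.starProjection p) ∈ closedBall p r := by
    have hcancel : (z : E n) + (p - H.starProjection p) - p = z - H.starProjection p := by abel
    rw [Metric.mem_closedBall, dist_eq_norm, hcancel]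
    rwa [Metric.mem_closedBall, dist_eq_norm] at hz
  have hproj := mem_cylinder.1 (h hlift)
  rwa [Submodule.eq_starProjection_of_mem_orthogonal' z.2
    (H.sub_starProjection_mem_orthogonal p) rfl] at hproj

end Cylinder

section BallShift

variable {n : ℕ} {u : E n} {D : Body n → FinMeas n}

lemma MeasPreserving.radius_eq_of_essEq_ball [Nontrivial (E n)] (hmeas : MeasPreserving D)
    {p q : E n} {r s : ℝ} {hr : 0 < r} {hs : 0 < s}
    (h : EssEq (D (ball p r hr)).1 (ball q s hs).set) : r = s :=
  radius_eq_of_addHaar_closedBall_eq hr.le hs.le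
    ((hmeas.volume_eq _).symm.trans (measure_congr (essEq_iff.1 h)))

lemma Monotonic.radius_add_dist_le [Nontrivial (E n)] (hmono : Monotonic D) {p q p' q' : E n}
    {r s r' s' : ℝ} {hr : 0 < r} {hs : 0 < s} {hr' : 0 < r'} {hs' : 0 < s'}
    (hp : EssEq (D (ball p r hr)).1 (ball p' r' hr').set)
    (hq : EssEq (D (ball q s hs)).1 (ball q' s' hs').set) (h : r + dist p q ≤ s) :
    r' + dist p' q' ≤ s' := by
  have hD : EssSubset (D (ball p r hr)).1 (D (ball q s hs)).1 :=
    hmono _ _ (Metric.closedBall_subset_closedBall' h).eventuallyLE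
  exact (closedBall_subset_closedBall_iff hr'.le).1
    (Body.subset_of_essSubset Metric.isClosed_closedBall (hp.symm.le.trans (hD.trans hq.le)))

lemma exists_essEq_ball [Nontrivial (E n)] (hmeas : MeasPreserving D)
    (hcyl : RespectsCylinders (hyp u) D) (hball : MapsBallsToBalls D) (x : hyp u) (t : ℝ) {r : ℝ}
    (hr : 0 < r) :
    ∃ s : ℝ, EssEq (D (ball ((x : E n) + t • u) r hr)).1 (ball ((x : E n) + s • u) r hr).set := by
  obtain ⟨q, r', hr', himage⟩ := hball ((x : E n) + t • u) r hr
  obtain rfl : r = r' := hmeas.radius_eq_of_essEq_ball himage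
  obtain ⟨y, s, rfl⟩ := exists_eq_add_smul u q
  have hsource : closedBall ((x : E n) + t • u) r ⊆ cylinder (hyp u) x r := by
    simpa only [starProjection_orthogonal_span_add_smul] using
      closedBall_subset_cylinder (hyp u) ((x : E n) + t • u) r
  have htarget : closedBall ((y : E n) + s • u) r ⊆ cylinder (hyp u) x r :=
    Body.subset_of_essSubset (K := ball ((y : E n) + s • u) r hr) (isClosed_cylinder _ _ _)
      (himage.symm.le.trans (hcyl _ _ _ hr hsource.eventuallyLE))
  have hyx := starProjection_eq_of_closedBall_subset_cylinder hr.le x.2 htarget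
  rw [starProjection_orthogonal_span_add_smul] at hyx
  exact ⟨s, hyx ▸ himage⟩

lemma exists_isBallShift (hn : 2 ≤ n) (hu : ‖u‖ = 1) (hmono : Monotonic D)
    (hmeas : MeasPreserving D) (hcyl : RespectsCylinders (hyp u) D) (hball : MapsBallsToBalls D) :
    ∃ ψ, IsBallShift u D ψ := by
  have : Nontrivial (E n) := ⟨u, 0, ne_zero_of_norm_ne_zero (hu ▸ one_ne_zero)⟩
  have : Nontrivial (hyp u) :=
    Module.nontrivial_of_finrank_pos (R := ℝ) (by have := finrank_hyp hu; omega)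
  choose! f hf using fun (x : hyp u) (t r : ℝ) (hr : 0 < r) =>
    exists_essEq_ball hmeas hcyl hball x t hr
  have hnested : ∀ (x y : hyp u) (t t' r s : ℝ), 0 < s → 0 < r →
      s + dist ((y : E n) + t' • u) ((x : E n) + t • u) ≤ r →
      s + dist ((y : E n) + f y t' s • u) ((x : E n) + f x t r • u) ≤ r :=
    fun x y t t' r s hs hr h => hmono.radius_add_dist_le (hf y t' s hs) (hf x t r hr) h
  have hconst : ∀ (x : hyp u) (t r : ℝ), 0 < r → f x t r = f 0 t 1 := by
    intro x t r hr
    refine eq_of_forall_internally_tangent (g := fun x r => f x t r) ?_ x 0 hr one_pos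
    intro x y r s hs htangent
    have himage := hnested x y t t r s hs (by linarith [dist_nonneg (x := y) (y := x)])
      (by rw [dist_add_right]; exact htangent.le)
    exact eq_of_dist_add_smul_le hu (by linarith)
  refine ⟨fun t => f 0 t 1, LipschitzWith.of_dist_le_mul fun t t' => ?_, fun x hx t r hr => ?_⟩
  · have hdist := hnested 0 0 t' t (1 + dist t t') 1 one_pos (by positivity) (by
      rw [(isometry_add_smul hu _).dist_eq])
    rw [(isometry_add_smul hu _).dist_eq, hconst 0 t' _ (by positivity)] at hdist
    simpa using hdist
  · simpa only [hconst _ t r hr] using hf ⟨x, hx⟩ t r hr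

lemma IsBallShift.unique (hu : u ≠ 0) {ψ φ : ℝ → ℝ} (hψ : IsBallShift u D ψ)
    (hφ : IsBallShift u D φ) : ψ = φ := by
  ext t
  have hballs : EssEq (ball (0 + ψ t • u) 1 one_pos).set (ball (0 + φ t • u) 1 one_pos).set :=
    (hψ.2 0 (zero_mem _) t 1 one_pos).symm.trans (hφ.2 0 (zero_mem _) t 1 one_pos)
  have hcenter := eq_of_closedBall_subset_closedBall zero_le_one
    (Body.subset_of_essSubset Metric.isClosed_closedBall hballs.le)
  exact smul_left_injective ℝ hu (add_left_cancel hcenter)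

lemma IsBallShift.eq_ballShift (hu : u ≠ 0) {φ : ℝ → ℝ} (hφ : IsBallShift u D φ) :
    φ = ballShift u D := by
  have hex : ∃ ψ, IsBallShift u D ψ := ⟨φ, hφ⟩
  rw [ballShift, dif_pos hex]
  exact hφ.unique hu hex.choose_spec

end BallShift

section Drum

variable {V : Type*} [NormedAddCommGroup V] [InnerProductSpace ℝ V] {u : V}

/-- The right circular cylinder with axis direction `u` whose points `y + s u` satisfy
`dist y x ≤ ρ` and `|s - c| ≤ a`. -/
def drum (hu : ‖u‖ = 1) (x : (ℝ ∙ u)ᗮ) (ρ c a : ℝ) : Set V :=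
  axisEquiv hu '' (closedBall x ρ ×ˢ closedBall c a)

lemma add_smul_mem_drum (hu : ‖u‖ = 1) {x y : (ℝ ∙ u)ᗮ} {s ρ c a : ℝ} :
    (y : V) + s • u ∈ drum hu x ρ c a ↔ dist y x ≤ ρ ∧ |s - c| ≤ a := by
  rw [drum, ← axisEquiv_apply hu (y, s), (axisEquiv hu).injective.mem_set_image]
  rfl

lemma convex_drum (hu : ‖u‖ = 1) (x : (ℝ ∙ u)ᗮ) (ρ c a : ℝ) : Convex ℝ (drum hu x ρ c a) :=
  ((convex_closedBall x ρ).prod (convex_closedBall c a)).linear_image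
    (axisEquiv hu).toLinearEquiv.toLinearMap

lemma interior_drum_nonempty (hu : ‖u‖ = 1) (x : (ℝ ∙ u)ᗮ) {ρ : ℝ} (c : ℝ) {a : ℝ} (hρ : 0 < ρ)
    (ha : 0 < a) : (interior (drum hu x ρ c a)).Nonempty := by
  have himage := (axisEquiv hu).toHomeomorph.image_interior (closedBall x ρ ×ˢ closedBall c a)
  rw [interior_prod_eq] at himage
  have hcentre : (x, c) ∈ interior (closedBall x ρ) ×ˢ interior (closedBall c a) :=
    ⟨Metric.ball_subset_interior_closedBall (Metric.mem_ball_self hρ),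
      Metric.ball_subset_interior_closedBall (Metric.mem_ball_self ha)⟩
  exact ⟨_, himage.le (mem_image_of_mem _ hcentre)⟩

lemma drum_subset_closedBall (hu : ‖u‖ = 1) (x : (ℝ ∙ u)ᗮ) {ρ c a R : ℝ} (hR : 0 ≤ R)
    (h : a ^ 2 + ρ ^ 2 ≤ R ^ 2) : drum hu x ρ c a ⊆ closedBall (x + c • u : V) R := by
  intro z hz
  obtain ⟨y, s, rfl⟩ := exists_eq_add_smul u z
  obtain ⟨hy, hs⟩ := (add_smul_mem_drum hu).1 hz
  refine (add_smul_mem_closedBall_iff hu hR).2 ?_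
  linarith [pow_le_pow_left₀ dist_nonneg hy 2, sq_le_sq' (abs_le.1 hs).1 (abs_le.1 hs).2]

lemma closedBall_subset_drum (hu : ‖u‖ = 1) (x : (ℝ ∙ u)ᗮ) {ρ s c a : ℝ} (h : |s - c| + ρ ≤ a) :
    closedBall (x + s • u : V) ρ ⊆ drum hu x ρ c a := by
  intro z hz
  obtain ⟨y, s', rfl⟩ := exists_eq_add_smul u z
  have hy := (dist_le_dist_add_smul hu y x s' s).trans hz
  have hs := (abs_sub_le_dist_add_smul hu y x s' s).trans hz
  exact (add_smul_mem_drum hu).2 ⟨hy, by linarith [abs_sub_le s' s c]⟩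

lemma eventually_drum_subset (hu : ‖u‖ = 1) {U : Set V} (hU : IsOpen U) {x : (ℝ ∙ u)ᗮ} {c a : ℝ}
    (h : closedBall c a ⊆ chord u U x) : ∀ᶠ ρ in 𝓝 (0 : ℝ), drum hu x ρ c a ⊆ U := by
  have haxis : {x} ×ˢ closedBall c a ⊆ axisEquiv hu ⁻¹' U := by
    rintro ⟨_, s⟩ ⟨rfl, hs⟩
    simpa using h hs
  obtain ⟨W, I, hW, -, hxW, hI, hWI⟩ := generalized_tube_lemma isCompact_singleton
    (isCompact_closedBall c a) (hU.preimage (axisEquiv hu).continuous) haxis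
  filter_upwards [eventually_closedBall_subset (hW.mem_nhds (hxW rfl))] with ρ hρ
  exact image_subset_iff.2 ((prod_mono hρ hI).trans hWI)

variable [FiniteDimensional ℝ V]

lemma isCompact_drum (hu : ‖u‖ = 1) (x : (ℝ ∙ u)ᗮ) (ρ c a : ℝ) : IsCompact (drum hu x ρ c a) :=
  ((isCompact_closedBall x ρ).prod (isCompact_closedBall c a)).image (axisEquiv hu).continuous

variable [MeasurableSpace V] [BorelSpace V]

lemma volume_drum (hu : ‖u‖ = 1) (x : (ℝ ∙ u)ᗮ) (ρ c a : ℝ) :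
    volume (drum hu x ρ c a) = volume (closedBall x ρ) * ENNReal.ofReal (2 * a) := by
  rw [← (measurePreserving_axisEquiv hu).measure_preimage
    (isCompact_drum hu x ρ c a).measurableSet.nullMeasurableSet, drum,
    (axisEquiv hu).injective.preimage_image, Measure.prod_prod, Real.volume_closedBall]

lemma volume_closedBall_mul_ofReal_le (hu : ‖u‖ = 1) (x : (ℝ ∙ u)ᗮ) (z : V) {ρ : ℝ} (hρ : 0 ≤ ρ) :
    volume (closedBall x ρ) * ENNReal.ofReal ρ ≤
      ENNReal.ofReal (2 ^ Module.finrank ℝ V) * volume (closedBall z ρ) := by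
  calc volume (closedBall x ρ) * ENNReal.ofReal ρ = volume (drum hu x ρ 0 (ρ / 2)) := by
        rw [volume_drum, mul_div_cancel₀ ρ two_ne_zero]
    _ ≤ volume (closedBall (x + (0 : ℝ) • u : V) (2 * ρ)) :=
        measure_mono (drum_subset_closedBall hu x (by positivity) (by nlinarith))
    _ = ENNReal.ofReal (2 ^ Module.finrank ℝ V) * volume (closedBall z ρ) := by
        rw [Measure.addHaar_closedBall_mul _ _ zero_le_two hρ,
          Measure.addHaar_closedBall_center _ z]

end Drum

section Density

variable {n : ℕ} {u : E n} {D : Body n → FinMeas n} {φ : ℝ → ℝ}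

/-- The drum as a convex body, to which a map on convex bodies can be applied. -/
def drumBody (hu : ‖u‖ = 1) (x : hyp u) (ρ c a : ℝ) (hρ : 0 < ρ) (ha : 0 < a) : Body n :=
  ⟨{ carrier := drum hu x ρ c a
     convex' := convex_drum hu x ρ c a
     isCompact' := isCompact_drum hu x ρ c a
     nonempty' := (interior_drum_nonempty hu x c hρ ha).mono interior_subset },
   interior_drum_nonempty hu x c hρ ha⟩

lemma drumBody_set (hu : ‖u‖ = 1) (x : hyp u) (ρ c a : ℝ) (hρ : 0 < ρ) (ha : 0 < a) :
    (drumBody hu x ρ c a hρ ha).set = drum hu x ρ c a := rfl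

lemma IsBallShift.image_drumBody_ae_le (hφ : IsBallShift u D φ) (hmono : Monotonic D)
    (hcyl : RespectsCylinders (hyp u) D) (hu : ‖u‖ = 1) (x : hyp u) {ρ a R : ℝ} (t : ℝ)
    (hρ : 0 < ρ) (ha : 0 < a) (hR : 0 < R) (h : a ^ 2 + ρ ^ 2 ≤ R ^ 2) :
    (D (drumBody hu x ρ t a hρ ha)).1 ≤ᵐ[volume] drum hu x ρ (φ t) R := by
  have hball : (D (drumBody hu x ρ t a hρ ha)).1 ≤ᵐ[volume] closedBall (x + φ t • u : E n) R :=
    essSubset_iff.1 ((hmono (drumBody hu x ρ t a hρ ha) (ball (x + t • u) R hR)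
      (drum_subset_closedBall hu x hR.le h).eventuallyLE).trans (hφ.2 x x.2 t R hR).le)
  have hcylinder : (D (drumBody hu x ρ t a hρ ha)).1 ≤ᵐ[volume] cylinder (hyp u) x ρ := by
    refine essSubset_iff.1 (hcyl _ _ _ hρ (LE.le.eventuallyLE fun z hz => ?_))
    obtain ⟨y, s, rfl⟩ := exists_eq_add_smul u z
    exact add_smul_mem_cylinder.2 ((add_smul_mem_drum hu).1 hz).1
  filter_upwards [hball, hcylinder] with z hzball hzcyl hz
  obtain ⟨y, s, rfl⟩ := exists_eq_add_smul u z
  exact (add_smul_mem_drum hu).2 ⟨add_smul_mem_cylinder.1 (hzcyl hz),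
    (abs_sub_le_dist_add_smul hu y x s (φ t)).trans (hzball hz)⟩

lemma IsBallShift.volume_drum_sdiff_image_drumBody (hφ : IsBallShift u D φ) (hmono : Monotonic D)
    (hmeas : MeasPreserving D) (hcyl : RespectsCylinders (hyp u) D) (hu : ‖u‖ = 1) (x : hyp u)
    {ρ a R : ℝ} (t : ℝ) (hρ : 0 < ρ) (ha : 0 < a) (hR : 0 < R) (h : a ^ 2 + ρ ^ 2 ≤ R ^ 2) :
    volume (drum hu x ρ (φ t) R \ (D (drumBody hu x ρ t a hρ ha)).1) =
      volume (closedBall x ρ) * ENNReal.ofReal (2 * (R - a)) := by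
  have hvolume : volume (D (drumBody hu x ρ t a hρ ha)).1 =
      volume (closedBall x ρ) * ENNReal.ofReal (2 * a) := by
    rw [hmeas.volume_eq, drumBody_set, volume_drum]
  have hbase : volume (closedBall x ρ) ≠ ⊤ := measure_closedBall_lt_top.ne
  rw [measure_sdiff' _ (FinMeas.nullMeasurableSet _)
      (hvolume ▸ ENNReal.mul_ne_top hbase ENNReal.ofReal_ne_top),
    measure_congr (union_ae_eq_left_iff_ae_subset.2
      (hφ.image_drumBody_ae_le hmono hcyl hu x t hρ ha hR h)),
    volume_drum, hvolume, ← ENNReal.mul_sub fun _ _ => hbase,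
    ← ENNReal.ofReal_sub _ (by positivity), mul_sub]

lemma exists_closedBall_subset_chord_interior {K : Set (E n)} (hK : Convex ℝ K) {x : hyp u} {s : ℝ}
    (hs : s ∈ chord u (movedSet u φ K) x) :
    ∃ t a, |s - φ t| < a ∧ closedBall t a ⊆ chord u (interior K) x := by
  obtain ⟨t, hplus, hminus⟩ := mem_chord_movedSet.1 hs
  have hopen : IsOpen (chord u (interior K) x) :=
    isOpen_interior.preimage (by fun_prop : Continuous fun s : ℝ => (x : E n) + s • u)
  have hsub : closedBall t |s - φ t| ⊆ chord u (interior K) x := by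
    rw [Real.closedBall_eq_Icc]
    rcases abs_choice (s - φ t) with h | h <;> rw [h]
    · exact (convex_chord hK.interior _).ordConnected.out hminus hplus
    · rw [sub_neg_eq_add, ← sub_eq_add_neg]
      exact (convex_chord hK.interior _).ordConnected.out hplus hminus
  obtain ⟨δ, hδ, hthick⟩ := (isCompact_closedBall t _).exists_cthickening_subset_open hopen hsub
  rw [cthickening_closedBall hδ.le (abs_nonneg _)] at hthick
  exact ⟨t, _, lt_add_of_pos_left _ hδ, hthick⟩

/-- For `R = a + ρ² / (2a)` a drum of radius `ρ` and half-height `a` lies in a ball of radius `R`,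
and its image misses only a volume of order `ρ^(n+1)` of the drum of half-height `R`. -/
lemma IsBallShift.eventually_volume_closedBall_sdiff_le (hφ : IsBallShift u D φ)
    (hmono : Monotonic D) (hmeas : MeasPreserving D) (hcyl : RespectsCylinders (hyp u) D)
    (hu : ‖u‖ = 1) (K : Body n) {x : hyp u} {s t a : ℝ} (hsa : |s - φ t| < a)
    (hchord : closedBall t a ⊆ chord u (interior K.set) x) :
    ∀ᶠ ρ in 𝓝[>] (0 : ℝ), volume (closedBall (x + s • u : E n) ρ \ (D K).1) ≤
      volume (closedBall x ρ) * ENNReal.ofReal (ρ * (ρ / a)) := by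
  have ha : 0 < a := (abs_nonneg _).trans_lt hsa
  filter_upwards [(eventually_drum_subset hu isOpen_interior hchord).filter_mono
    nhdsWithin_le_nhds, Ioc_mem_nhdsGT (sub_pos.2 hsa)] with ρ hdrum ⟨hρ, hρa⟩
  set R := a + ρ ^ 2 / (2 * a) with hR
  have haR : a ≤ R := le_add_of_nonneg_right (by positivity)
  have hsq : a ^ 2 + ρ ^ 2 ≤ R ^ 2 := by
    have hexpand : R ^ 2 = a ^ 2 + ρ ^ 2 + (ρ ^ 2 / (2 * a)) ^ 2 := by rw [hR]; field_simp; ring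
    linarith [sq_nonneg (ρ ^ 2 / (2 * a))]
  have hDK : (D (drumBody hu x ρ t a hρ ha)).1 ≤ᵐ[volume] (D K).1 :=
    essSubset_iff.1 (hmono _ _ (hdrum.trans interior_subset).eventuallyLE)
  calc volume (closedBall (x + s • u : E n) ρ \ (D K).1)
      ≤ volume (drum hu x ρ (φ t) R \ (D (drumBody hu x ρ t a hρ ha)).1) :=
        measure_mono_ae <| EventuallyLE.diff
          (closedBall_subset_drum hu x (by linarith)).eventuallyLE hDK
    _ = volume (closedBall x ρ) * ENNReal.ofReal (ρ * (ρ / a)) := by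
        rw [hφ.volume_drum_sdiff_image_drumBody hmono hmeas hcyl hu x t hρ ha (ha.trans_le haR) hsq,
          show 2 * (R - a) = ρ * (ρ / a) by rw [hR]; field_simp; ring]

lemma IsBallShift.tendsto_volume_closedBall_sdiff_div (hφ : IsBallShift u D φ)
    (hmono : Monotonic D) (hmeas : MeasPreserving D) (hcyl : RespectsCylinders (hyp u) D)
    (hu : ‖u‖ = 1) (K : Body n) {z : E n} (hz : z ∈ movedSet u φ K.set) :
    Tendsto (fun ρ => volume (closedBall z ρ \ (D K).1) / volume (closedBall z ρ))
      (𝓝[>] 0) (𝓝 0) := by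
  obtain ⟨x, s, rfl⟩ := exists_eq_add_smul u z
  obtain ⟨t, a, hsa, hchord⟩ := exists_closedBall_subset_chord_interior K.convex hz
  have hlim : Tendsto (fun ρ => ENNReal.ofReal (2 ^ Module.finrank ℝ (E n)) *
      ENNReal.ofReal (ρ / a)) (𝓝[>] 0) (𝓝 0) := by
    have hcont : Continuous fun ρ : ℝ => ENNReal.ofReal (2 ^ Module.finrank ℝ (E n)) *
        ENNReal.ofReal (ρ / a) :=
      (ENNReal.continuous_const_mul ENNReal.ofReal_ne_top).comp
        (ENNReal.continuous_ofReal.comp (continuous_id.div_const a))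
    simpa using (hcont.tendsto 0).mono_left nhdsWithin_le_nhds
  refine tendsto_of_tendsto_of_tendsto_of_le_of_le' tendsto_const_nhds hlim
    (Eventually.of_forall fun _ => zero_le) ?_
  filter_upwards [hφ.eventually_volume_closedBall_sdiff_le hmono hmeas hcyl hu K hsa hchord,
    self_mem_nhdsWithin] with ρ hbound hρ
  refine ENNReal.div_le_of_le_mul (hbound.trans ?_)
  rw [ENNReal.ofReal_mul (le_of_lt hρ), ← mul_assoc, mul_right_comm (ENNReal.ofReal _)]
  exact mul_le_mul_left (volume_closedBall_mul_ofReal_le hu x _ (le_of_lt hρ)) _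

lemma IsBallShift.essEq_movedSet (hφ : IsBallShift u D φ) (hmono : Monotonic D)
    (hmeas : MeasPreserving D) (hcyl : RespectsCylinders (hyp u) D) (hu : ‖u‖ = 1) (K : Body n) :
    EssEq (D K).1 (movedSet u φ K.set) := by
  have hsub : movedSet u φ K.set ≤ᵐ[volume] (D K).1 :=
    ae_le_of_tendsto_measure_closedBall_sdiff (FinMeas.nullMeasurableSet _) fun _ hz =>
      hφ.tendsto_volume_closedBall_sdiff_div hmono hmeas hcyl hu K hz
  have hvolume : volume (D K).1 = volume (movedSet u φ K.set) := by
    rw [hmeas.volume_eq, volume_movedSet hu hφ.1]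
  refine essEq_iff.2 (ae_eq_of_ae_subset_of_measure_ge hsub hvolume.le
    (isOpen_movedSet u φ K.set).nullMeasurableSet ?_).symm
  exact hmeas.volume_eq K ▸ K.isCompact.measure_ne_top

end Density

section Converse

variable {n : ℕ} {u : E n} {D : Body n → FinMeas n} {φ : ℝ → ℝ}

lemma monotonic_of_essEq_movedSet (h : ∀ K, EssEq (D K).1 (movedSet u φ K.set)) : Monotonic D :=
  fun K L hKL => (h K).le.trans <|
    (movedSet_mono (Body.subset_of_essSubset L.isCompact.isClosed hKL)).eventuallyLE.trans
      (h L).symm.le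

lemma measPreserving_of_essEq_movedSet (hu : ‖u‖ = 1) (hφ : LipschitzWith 1 φ)
    (h : ∀ K, EssEq (D K).1 (movedSet u φ K.set)) : MeasPreserving D := fun K => by
  rw [measure_congr (h K), haus_eq_volume, volume_movedSet hu hφ]

lemma respectsCylinders_of_essEq_movedSet (h : ∀ K, EssEq (D K).1 (movedSet u φ K.set)) :
    RespectsCylinders (hyp u) D := by
  intro K c r _ hK
  refine (h K).le.trans (LE.le.eventuallyLE fun z hz => ?_)
  obtain ⟨x, s, rfl⟩ := exists_eq_add_smul u z
  obtain ⟨t, ht, -⟩ := mem_chord_movedSet.1 hz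
  have hKc := Body.subset_of_essSubset (isClosed_cylinder (hyp u) c r) hK (interior_subset ht)
  exact add_smul_mem_cylinder.2 (add_smul_mem_cylinder.1 hKc)

lemma ball_subset_movedSet (hu : ‖u‖ = 1) (φ : ℝ → ℝ) (x : hyp u) (t : ℝ) {r : ℝ} (hr : 0 ≤ r) :
    Metric.ball (x + φ t • u : E n) r ⊆ movedSet u φ (closedBall (x + t • u : E n) r) := by
  intro z hz
  obtain ⟨y, s, rfl⟩ := exists_eq_add_smul u z
  rw [add_smul_mem_ball_iff hu hr] at hz
  refine mem_chord_movedSet.2 ⟨t, ?_, ?_⟩ <;>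
    refine Metric.ball_subset_interior_closedBall ((add_smul_mem_ball_iff hu hr).2 ?_) <;>
    linarith

lemma isBallShift_of_essEq_movedSet (hu : ‖u‖ = 1) (hφ : LipschitzWith 1 φ)
    (h : ∀ K, EssEq (D K).1 (movedSet u φ K.set)) : IsBallShift u D φ := by
  have : Nontrivial (E n) := ⟨u, 0, ne_zero_of_norm_ne_zero (hu ▸ one_ne_zero)⟩
  refine ⟨hφ, fun x hx t r hr => (h _).trans (essEq_iff.2 ?_)⟩
  have hvolume : volume (movedSet u φ (ball (x + t • u) r hr).set) =
      volume (Metric.ball (x + φ t • u) r) := by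
    rw [volume_movedSet hu hφ, ball_set, Measure.addHaar_closedBall_eq_addHaar_ball,
      Measure.addHaar_ball_center, Measure.addHaar_ball_center volume (x + φ t • u)]
  have hball : Metric.ball (x + φ t • u) r =ᵐ[volume] movedSet u φ (ball (x + t • u) r hr).set :=
    ae_eq_of_subset_of_measure_ge (ball_subset_movedSet hu φ ⟨x, hx⟩ t hr.le) hvolume.le
      measurableSet_ball.nullMeasurableSet (hvolume ▸ measure_ball_lt_top.ne)
  exact hball.symm.trans (ball_ae_eq_closedBall _ r)

lemma IsBallShift.mapsBallsToBalls (hφ : IsBallShift u D φ) : MapsBallsToBalls D := by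
  intro z r hr
  obtain ⟨x, t, rfl⟩ := exists_eq_add_smul u z
  exact ⟨_, r, hr, hφ.2 x x.2 t r hr⟩

end Converse

end ChordMovement

theorem mainTheorem5 (n : ℕ) (hn : 2 ≤ n) (u : ChordMovement.E n) (hu : ‖u‖ = 1)
    (D : ChordMovement.Body n → ChordMovement.FinMeas n)
    (φ : ℝ → ℝ) (hφ : LipschitzWith 1 φ) :
    List.TFAE [
      (ChordMovement.Monotonic D ∧ ChordMovement.MeasPreserving D ∧
        ChordMovement.RespectsCylinders (ChordMovement.hyp u) D ∧
        ChordMovement.MapsBallsToBalls D) ∧ φ = ChordMovement.ballShift u D,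
      ∀ K : ChordMovement.Body n,
        ChordMovement.EssEq (D K).1
          (⋃ t : ℝ, interior
            (ChordMovement.translate (ChordMovement.symPart u K.set t) (φ t • u))),
      ∀ K : ChordMovement.Body n,
        ∀ᵐ x : ChordMovement.hyp u ∂(ChordMovement.haus (n - 1)),
          ((D K).1 ∩ ChordMovement.perpLine (ChordMovement.hyp u) (x : ChordMovement.E n) :
              Set (ChordMovement.E n))
            =ᵐ[ChordMovement.haus 1]
          (ChordMovement.translate
            (K.set ∩ ChordMovement.perpLine (ChordMovement.hyp u) (x : ChordMovement.E n))
            ((φ (ChordMovement.midHeight u K.set x) - ChordMovement.midHeight u K.set x) • u) :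
              Set (ChordMovement.E n))] := by
  have hu0 : u ≠ 0 := ne_zero_of_norm_ne_zero (hu ▸ one_ne_zero)
  tfae_have 2 ↔ 3 := forall_congr' fun K => ChordMovement.essEq_movedSet_iff hu hφ K (D K)
  tfae_have 1 → 2 := by
    rintro ⟨⟨hmono, hmeas, hcyl, hball⟩, rfl⟩ K
    obtain ⟨ψ, hψ⟩ := ChordMovement.exists_isBallShift hn hu hmono hmeas hcyl hball
    rw [← hψ.eq_ballShift hu0]
    exact hψ.essEq_movedSet hmono hmeas hcyl hu K
  tfae_have 2 → 1 := by
    intro h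
    have hshift := ChordMovement.isBallShift_of_essEq_movedSet hu hφ h
    exact ⟨⟨ChordMovement.monotonic_of_essEq_movedSet h,
      ChordMovement.measPreserving_of_essEq_movedSet hu hφ h,
      ChordMovement.respectsCylinders_of_essEq_movedSet h, hshift.mapsBallsToBalls⟩,
      hshift.eq_ballShift hu0⟩
  tfae_finish
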